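/- **Setting.** Let $\mathcal G=(\mathcal V,\mathcal E)$ be a finite directed graph with vertices $v_{\rm source},v_{\rm target}$. Each edge $e$ has a lazy estimate $\hat w(e)\in(0,\infty)$ and a true weight $w(e)$, where $w(e)=\hat w(e)$ if $e$ is not in collision and $w(e)=\infty$ if $e$ is in collision. *Evaluating* $e$ means computing $w(e)$. The lazy cost of a path is the sum of the lazy estimates of its edges. Assume that no two distinct simple paths starting at $v_{\rm source}$ have the same lazy cost. **The algorithm LRA\*** with lookahead $\alpha\in\{1,2,\dots\}\cup\{\infty\}$ maintains a search tree $\mathcal T$ rooted at $v_{\rm source}$, with at most one node per vertex. The tree path to a node consists of a head (evaluated, collision-free edges) followed by a tail (unevaluated edges). The *key* of a node is the cost of the head plus the lazy cost of the tail, and its *budget* is the number of edges of the tail. A node is a *frontier node* if its budget equals $\alpha$ or its vertex is $v_{\rm target}$. *Extending the band:* as long as there is an edge $(u,v)$ of the current graph such that $u\ne v_{\rm target}$ is in $\mathcal T$ with budget $<\alpha$, and $v$ either is not in $\mathcal T$ or would get a strictly smaller key with $u$ as its parent, choose such an edge and make $u$ the parent of $v$; if $v$ was already in $\mathcal T$,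 its old subtree is removed. Start with $\mathcal T=\{v_{\rm source}\}$, with key and budget $0$, and extend the band. Then repeat the following until $v_{\rm target}$ is in $\mathcal T$ with budget $0$ (the target is reached) or there is no frontier node (failure). Choose a frontier node with minimal key and evaluate the first edge $(u,v)$ of the tail of its tree path. If $(u,v)$ is not in collision, it moves from the tail to the head of the paths to $v$ and to all its descendants. If it is in collision, it is removed from the graph and the subtree rooted at $v$ is detached. Unless $v_{\rm target}$ has been reached, extend the band again (this includes rewiring the detached vertices to new parents). **Lemma.** For every such problem and all lookaheads $\alpha_1>\alpha_2\ge 1$ (where $\alpha_1=\infty$ is allowed), LRA\* has complete (finite, stopped) executions with lookahead $\alpha_1$ and with lookahead $\alpha_2$, and $$E_1\subseteq E_2$$ whenever $E_i$ is the set of edges evaluated in a complete execution of LRA\* with lookahead $\alpha_i$, $i\in\{1,2\}$, whatever order was chosen for the extension steps. Thus a larger lookahead never causes more edge evaluations. -/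

import Mathlib

/-- A shortest-path problem on a directed graph with vertex type `V`: the edges, the lazy estimate
`lazyW` of the edge weights, the true weight function `w`, and the source and target vertices.
Lazy estimates are positive; the true weight of an edge equals its lazy estimate
if the edge is not in collision, and is infinite if the edge is in collision. -/
structure ShortestPathProblem (V : Type*) where
  edges : Set (V × V)
  lazyW : V × V → ℝ
  w : V × V → WithTop ℝ
  source : V
  target : V
  lazyW_pos : ∀ e ∈ edges, 0 < lazyW e
  w_eq : ∀ e ∈ edges, w e = (lazyW e : WithTop ℝ) ∨ w e = ⊤

namespace ShortestPathProblem

variable {V : Type*}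

/-- The list of vertices `p` is a simple path of the graph that starts at the source. -/
def IsPathFromSource (P : ShortestPathProblem V) (p : List V) : Prop :=
  p.head? = some P.source ∧ p.Nodup ∧ p.IsChain (fun x y => (x, y) ∈ P.edges)

/-- The lazy cost of a path: the sum of the lazy estimates of its edges. -/
def lazyCost (P : ShortestPathProblem V) (p : List V) : ℝ :=
  ((p.zip p.tail).map P.lazyW).sum

/-- No two different simple paths from the source have the same lazy cost. -/
def NoTies (P : ShortestPathProblem V) : Prop :=
  ∀ p q : List V, P.IsPathFromSource p → P.IsPathFromSource q →
    P.lazyCost p = P.lazyCost q → p = q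

end ShortestPathProblem

namespace LRAStar

/-- The entry of a node of the search tree: its parent (`none` for the root), the cost `c` of the
evaluated part (head) of its tree path, the lazy cost `l` of the part of its tree path that is not
evaluated (tail), and its budget `b`, the number of edges of the tail. -/
structure Node (V : Type*) where
  parent : Option V
  c : ℝ
  l : ℝ
  b : ℕ

/-- The estimated cost-to-come of a node. -/
def Node.key {V : Type*} (n : Node V) : ℝ := n.c + n.l

/-- A state of the algorithm: the edges still in the graph, the edges evaluated so far, and the
search tree, with at most one node for each vertex. -/
structure State (V : Type*) where
  edges : Set (V × V)
  evaluated : Set (V × V)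
  tree : V → Option (Node V)

variable {V : Type*}

/-- The vertices of the subtree of the search tree that is rooted at `v`. -/
def State.subtree (s : State V) (v : V) : Set V :=
  {x | Relation.ReflTransGen (fun y z => ∃ n, s.tree z = some n ∧ n.parent = some y) v x}

open Classical in
/-- The initial state: nothing is evaluated, and the search tree consists of the source. -/
noncomputable def init (P : ShortestPathProblem V) : State V where
  edges := P.edges
  evaluated := ∅
  tree := fun x => if x = P.source then some ⟨none, 0, 0, 0⟩ else none

/-- The edge `(u, v)` asks for an extension of the search tree through `u`: the node of `u` is in
the tree, is not the target, has budget less than the lookahead, and `v` either is not in the tree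
or would get a smaller key with `u` as its parent. -/
def CanAttach (P : ShortestPathProblem V) (α : ℕ∞) (s : State V) (u v : V) : Prop :=
  ∃ n, s.tree u = some n ∧ u ≠ P.target ∧ (n.b : ℕ∞) < α ∧ (u, v) ∈ s.edges ∧
    ∀ m, s.tree v = some m → n.key + P.lazyW (u, v) < m.key

open Classical in
/-- Make `u` (with entry `n`) the parent of `v`. If `v` is already in the search tree,
then its old subtree is removed. -/
noncomputable def attach (P : ShortestPathProblem V) (s : State V) (u : V) (n : Node V) (v : V) :
    State V :=
  { s with
    tree := fun x =>
      if x = v then some ⟨some u, n.c, n.l + P.lazyW (u, v), n.b + 1⟩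
      else if x ∈ s.subtree v then none
      else s.tree x }

/-- One elementary step of rewiring or of extending the lazy band. -/
def AttachStep (P : ShortestPathProblem V) (α : ℕ∞) (s s' : State V) : Prop :=
  ∃ u v n, s.tree u = some n ∧ CanAttach P α s u v ∧ s' = attach P s u n v

/-- `s'` arises from `s` by rewiring nodes to better parents and extending the lazy band, in any
order, until no node with budget less than the lookahead is left to be extended. (Rewiring the
detached nodes one after another to their best parents in the tree, and then extending the band
from the node with least key on, is one of these orders.) -/
def ExtendBand (P : ShortestPathProblem V) (α : ℕ∞) (s s' : State V) : Prop :=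
  Relation.ReflTransGen (AttachStep P α) s s' ∧ ∀ u v, ¬ CanAttach P α s' u v

/-- The vertex `x` has a frontier node, with entry `n`: the budget of the node equals the lookahead,
or `x` is the target, which is never extended. -/
def IsFrontier (P : ShortestPathProblem V) (α : ℕ∞) (s : State V) (x : V) (n : Node V) : Prop :=
  s.tree x = some n ∧ ((n.b : ℕ∞) = α ∨ x = P.target)

/-- The frontier node of `x` has minimal key among all frontier nodes. -/
def IsNext (P : ShortestPathProblem V) (α : ℕ∞) (s : State V) (x : V) : Prop :=
  ∃ n, IsFrontier P α s x n ∧ ∀ y m, IsFrontier P α s y m → n.key ≤ m.key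

/-- `(u, v)` is the first edge of the tail of the tree path to `x`: the last vertex on this path
with budget `0` is `u`, and `v` is its successor. -/
def IsFirstTailEdge (s : State V) (x u v : V) : Prop :=
  x ∈ s.subtree v ∧
    ∃ n m, s.tree u = some n ∧ s.tree v = some m ∧ m.parent = some u ∧ n.b = 0 ∧ 0 < m.b

open Classical in
/-- Evaluation of the edge `(u, v)`, where `v` is a child of `u` in the search tree.
If the edge is free of collision, then in the entries of `v` and of all its descendants it moves
from the tail of the path to the head. If it is in collision, then it is removed
from the graph, and the subtree rooted at `v` is detached from the search tree. -/
noncomputable def evaluate (P : ShortestPathProblem V) (s : State V) (u v : V) : State V :=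
  if P.w (u, v) = (P.lazyW (u, v) : WithTop ℝ) then
    { edges := s.edges
      evaluated := insert (u, v) s.evaluated
      tree := fun x =>
        if x ∈ s.subtree v then
          (s.tree x).map fun n =>
            ⟨n.parent, n.c + P.lazyW (u, v), n.l - P.lazyW (u, v), n.b - 1⟩
        else s.tree x }
  else
    { edges := s.edges \ {(u, v)}
      evaluated := insert (u, v) s.evaluated
      tree := fun x => if x ∈ s.subtree v then none else s.tree x }

/-- The target has been reached by a path all of whose edges are evaluated. -/
def Done (P : ShortestPathProblem V) (s : State V) : Prop :=
  ∃ n, s.tree P.target = some n ∧ n.b = 0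

/-- One iteration of the main loop: a frontier node with minimal key is chosen, and the first edge
of the tail of its tree path is evaluated; unless the target is reached by this,
nodes are rewired and the lazy band is extended again. -/
def Iteration (P : ShortestPathProblem V) (α : ℕ∞) (s s' : State V) : Prop :=
  ¬ Done P s ∧ ∃ x u v, IsNext P α s x ∧ IsFirstTailEdge s x u v ∧
    ((Done P (evaluate P s u v) ∧ s' = evaluate P s u v) ∨
      (¬ Done P (evaluate P s u v) ∧ ExtendBand P α (evaluate P s u v) s'))

/-- The algorithm stops in the state `s`: the target has been reached, or there is
no frontier node (failure). -/
def Stops (P : ShortestPathProblem V) (α : ℕ∞) (s : State V) : Prop :=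
  Done P s ∨ ∀ x n, ¬ IsFrontier P α s x n

/-- `E` is the set of the edges evaluated in a complete execution of LRA* with lookahead `α`. -/
def IsEvaluatedSet (P : ShortestPathProblem V) (α : ℕ∞) (E : Set (V × V)) : Prop :=
  ∃ s₀ s, ExtendBand P α (init P) s₀ ∧ Relation.ReflTransGen (Iteration P α) s₀ s ∧
    Stops P α s ∧ s.evaluated = E

end LRAStar

/-! Fix the final state `t` of a run with the smaller lookahead `β` and follow a run with the larger
lookahead `α`; by induction, every edge that it evaluates is evaluated in `t`. Suppose that the next
edge `(u, v)`, on the tree path to the frontier node `x` of minimal key, were not. The nodes on this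
path are optimal in the current graph, which contains the graph of `t`. Since `t` is closed under
extension and there are no ties, the path reappears in `t` with the same keys and budgets until it
meets a frontier node of `t` with positive budget. It must meet one, because `x` has budget `α > β`
or is the target. So `t` has not failed. If `t` has reached the target, the target's key is at most
the key of that frontier node. Then either this node is the target itself, which is absurd as its
budget is positive, or the target is cheaper than `x`, against the choice of `x`
(`Good.mem_evaluated`).

The invariant `Inv` supports this: nodes of budget 0 are optimal, and an evaluated edge that is
still in the graph is a tree edge between such nodes. Complete executions exist because extension
steps increase the set of keys in a colexicographic order (`Inv.exists_extendBand`) and each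
iteration evaluates a new edge (`Good.iteration`). -/

namespace LRAStar

/-! ### Walks, the state invariant and tree paths -/

variable {V : Type*} {P : ShortestPathProblem V} {α : ℕ∞} {s : State V}

/-- There is a walk from the source to the vertex, with edges in `E`, of the given lazy cost. -/
inductive Walk (P : ShortestPathProblem V) (E : Set (V × V)) : V → ℝ → Prop
  | nil : Walk P E P.source 0
  | snoc {u v : V} {c : ℝ} : Walk P E u c → (u, v) ∈ E → Walk P E v (c + P.lazyW (u, v))

theorem Walk.mono {E F : Set (V × V)} (h : E ⊆ F) {v : V} {c : ℝ} (hw : Walk P E v c) :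
    Walk P F v c := by
  induction hw with
  | nil => exact .nil
  | snoc _ he ih => exact ih.snoc (h he)

theorem Walk.nonneg {v : V} {c : ℝ} (hw : Walk P P.edges v c) : 0 ≤ c := by
  induction hw with
  | nil => exact le_rfl
  | snoc _ he ih =>
    have := P.lazyW_pos _ he
    linarith

/-- The node `n` of `v` is a child of the node `m` of `u`. -/
structure IsChild (P : ShortestPathProblem V) (s : State V) (u v : V) (m n : Node V) : Prop where
  left : s.tree u = some m
  right : s.tree v = some n
  parent : n.parent = some u
  ne_target : u ≠ P.target
  ne_source : v ≠ P.source
  mem_edges : (u, v) ∈ s.edges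
  key : n.key = m.key + P.lazyW (u, v)
  budget : (n.b = m.b + 1 ∧ (u, v) ∉ s.evaluated) ∨ (m.b = 0 ∧ n.b = 0 ∧ (u, v) ∈ s.evaluated)

/-- The properties of a state that every step of the algorithm preserves. -/
structure Inv (P : ShortestPathProblem V) (α : ℕ∞) (s : State V) : Prop where
  edges : ∀ e, e ∈ s.edges ↔
    e ∈ P.edges ∧ (e ∈ s.evaluated → P.w e = (P.lazyW e : WithTop ℝ))
  root : s.tree P.source = some ⟨none, 0, 0, 0⟩
  child : ∀ v n, s.tree v = some n → v ≠ P.source → ∃ u m, IsChild P s u v m n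
  evaluated_left : ∀ u v, (u, v) ∈ s.evaluated → ∃ n, s.tree u = some n ∧ n.b = 0
  evaluated_right : ∀ u v, (u, v) ∈ s.evaluated → (u, v) ∈ s.edges →
    ∃ n, s.tree v = some n ∧ n.parent = some u ∧ n.b = 0
  optimal : ∀ v n c, s.tree v = some n → n.b = 0 → Walk P s.edges v c → n.key ≤ c
  budget_le : ∀ v n, s.tree v = some n → (n.b : ℕ∞) ≤ α

namespace Inv

theorem edges_subset (h : Inv P α s) : s.edges ⊆ P.edges := fun e he => ((h.edges e).1 he).1

theorem isChild_of_parent (h : Inv P α s) {u v : V} {n : Node V} (hn : s.tree v = some n)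
    (hp : n.parent = some u) : ∃ m, IsChild P s u v m n := by
  by_cases hv : v = P.source
  · subst hv
    rw [h.root] at hn
    cases hn
    simp at hp
  · obtain ⟨u', m, hc⟩ := h.child v n hn hv
    have := hc.parent.symm.trans hp
    cases this
    exact ⟨m, hc⟩

theorem key_lt (h : Inv P α s) {u v : V} {m n : Node V} (hc : IsChild P s u v m n) :
    m.key < n.key := by
  have := P.lazyW_pos _ (h.edges_subset hc.mem_edges)
  rw [hc.key]
  linarith

/-- Induction along the search tree, from the root. -/
theorem induction [Finite V] (h : Inv P α s) {motive : V → Node V → Prop}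
    (root : motive P.source ⟨none, 0, 0, 0⟩)
    (step : ∀ u v m n, IsChild P s u v m n → motive u m → motive v n) :
    ∀ v n, s.tree v = some n → motive v n := by
  -- Lazy estimates are positive, so keys increase strictly along tree edges; comparison of keys is
  -- well-founded on the finite vertex set.
  let r : V → V → Prop := fun y z =>
    ∃ n m, s.tree y = some n ∧ s.tree z = some m ∧ n.key < m.key
  have : IsTrans V r := ⟨by
    rintro a b c ⟨n, m, h1, h2, h3⟩ ⟨n', m', h1', h2', h3'⟩
    rw [h2] at h1'
    cases h1'
    exact ⟨n, m', h1, h2', h3.trans h3'⟩⟩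
  have : Std.Irrefl r := ⟨by
    rintro a ⟨n, m, h1, h2, h3⟩
    rw [h1] at h2
    cases h2
    exact lt_irrefl _ h3⟩
  have wf : WellFounded r := Finite.wellFounded_of_trans_of_irrefl r
  intro v
  induction v using wf.induction with
  | _ v ih =>
    intro n hn
    by_cases hv : v = P.source
    · subst hv
      rw [h.root] at hn
      cases hn
      exact root
    · obtain ⟨u, m, hc⟩ := h.child v n hn hv
      exact step u v m n hc (ih u ⟨m, n, hc.left, hn, h.key_lt hc⟩ m hc.left)

theorem walk [Finite V] (h : Inv P α s) :
    ∀ v n, s.tree v = some n → Walk P s.edges v n.key := by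
  refine h.induction ?_ ?_
  · simpa [Node.key] using Walk.nil (P := P) (E := s.edges)
  · intro u v m n hc ih
    rw [hc.key]
    exact ih.snoc hc.mem_edges

theorem key_nonneg [Finite V] (h : Inv P α s) : ∀ v n, s.tree v = some n → 0 ≤ n.key := by
  refine h.induction ?_ ?_
  · simp [Node.key]
  · intro u v m n hc ih
    exact ih.trans (h.key_lt hc).le

/-- Every node has a tree path, a simple path whose lazy cost is the key of the node. -/
theorem path [Finite V] (h : Inv P α s) : ∀ v n, s.tree v = some n →
    ∃ p, P.IsPathFromSource (p ++ [v]) ∧ P.lazyCost (p ++ [v]) = n.key ∧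
      n.parent = p.getLast? ∧ ∀ x ∈ p, ∃ m, s.tree x = some m ∧ m.key < n.key := by
  have hcost : ∀ (p : List V) (u v : V),
      P.lazyCost (p ++ [u] ++ [v]) = P.lazyCost (p ++ [u]) + P.lazyW (u, v) := by
    intro p u v
    induction p with
    | nil => simp [ShortestPathProblem.lazyCost]
    | cons a p ih =>
      cases p with
      | nil => simp [ShortestPathProblem.lazyCost]
      | cons b p =>
        simp only [ShortestPathProblem.lazyCost, List.cons_append, List.tail_cons,
          List.zip_cons_cons, List.map_cons, List.sum_cons] at ih ⊢
        rw [ih]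
        ring
  refine h.induction ?_ ?_
  · refine ⟨[], ⟨rfl, by simp, by simp⟩, ?_, rfl, by simp⟩
    simp [ShortestPathProblem.lazyCost, Node.key]
  · rintro u v m n hc ⟨p, ⟨h1, h2, h3⟩, h4, h5, h6⟩
    have hlt := h.key_lt hc
    -- All earlier vertices have smaller keys, so the new vertex cannot repeat one of them.
    have hlt' : ∀ x ∈ p ++ [u], ∃ m, s.tree x = some m ∧ m.key < n.key := by
      intro x hx
      rcases List.mem_append.1 hx with hx | hx
      · obtain ⟨k, hk, hk'⟩ := h6 x hx
        exact ⟨k, hk, hk'.trans hlt⟩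
      · rw [List.mem_singleton.1 hx]
        exact ⟨m, hc.left, hlt⟩
    refine ⟨p ++ [u], ⟨?_, ?_, ?_⟩, ?_, ?_, hlt'⟩
    · rw [List.head?_append, h1]
      rfl
    · refine List.nodup_append.2 ⟨h2, by simp, ?_⟩
      rintro a ha b hb rfl
      obtain ⟨k, hk, hk'⟩ := hlt' a ha
      rw [List.mem_singleton.1 hb, hc.right] at hk
      cases hk
      exact lt_irrefl _ hk'
    · refine List.isChain_append.2 ⟨h3, by simp, ?_⟩
      simpa using h.edges_subset hc.mem_edges
    · rw [hcost, h4, hc.key]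
    · simpa using hc.parent

/-- Tree paths are simple paths of the original graph, so `NoTies` applies even across two states
with different lookaheads: equal keys mean equal tree paths. -/
theorem eq_of_key_eq [Finite V] (hP : P.NoTies) {β : ℕ∞} {t : State V} (h : Inv P α s)
    (h' : Inv P β t) {x y : V} {n m : Node V} (hn : s.tree x = some n) (hm : t.tree y = some m)
    (hk : n.key = m.key) : x = y ∧ n.parent = m.parent := by
  obtain ⟨p, h1, h2, h3, -⟩ := h.path x n hn
  obtain ⟨q, h1', h2', h3', -⟩ := h'.path y m hm
  have := hP _ _ h1 h1' (by rw [h2, h2', hk])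
  obtain ⟨rfl, hxy⟩ := List.append_inj' this rfl
  exact ⟨by simpa using hxy, by rw [h3, h3']⟩

/-- Each tree edge raises the key. It also raises the budget by one, unless it is evaluated, and
evaluated tree edges only join nodes of budget 0. -/
theorem subtree_cases (h : Inv P α s) {v x : V} (hx : x ∈ s.subtree v) :
    x = v ∨ ∃ m n, s.tree v = some m ∧ s.tree x = some n ∧ m.key < n.key ∧
      m.b ≤ n.b ∧ (0 < m.b → m.b < n.b) := by
  induction hx with
  | refl => exact Or.inl rfl
  | tail _ hz ih =>
    right
    obtain ⟨n, hn, hp⟩ := hz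
    obtain ⟨m, hc⟩ := h.isChild_of_parent hn hp
    have hlt := h.key_lt hc
    have hb := hc.budget
    rcases ih with rfl | ⟨m', n', h1, h2, h3, h4, h5⟩
    · exact ⟨m, n, hc.left, hn, hlt, by omega, by omega⟩
    · rw [hc.left] at h2
      cases h2
      exact ⟨m', n, h1, hn, h3.trans hlt, by omega, by omega⟩

theorem source_notMem_subtree (h : Inv P α s) {v : V} (hv : v ≠ P.source) :
    P.source ∉ s.subtree v := by
  intro hx
  rcases Relation.ReflTransGen.cases_tail hx with h1 | ⟨y, -, n, hn, hp⟩
  · exact hv h1.symm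
  · rw [h.root] at hn
    cases hn
    simp at hp

/-- This is why rewiring and detaching never touch the evaluated part of the tree. -/
theorem notMem_subtree_of_budget_zero (h : Inv P α s) {v x : V} {n : Node V}
    (hv : ∀ m, s.tree v = some m → 0 < m.b) (hx : s.tree x = some n) (hb : n.b = 0) :
    x ∉ s.subtree v := by
  intro hxv
  rcases h.subtree_cases hxv with rfl | ⟨m, n', h1, h2, -, -, h5⟩
  · have := hv n hx
    omega
  · rw [hx] at h2
    cases h2
    have := h5 (hv m h1)
    omega

end Inv

theorem mem_subtree_child {y z v : V} {n : Node V} (hn : s.tree z = some n)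
    (hp : n.parent = some y) (hy : y ∈ s.subtree v) : z ∈ s.subtree v :=
  Relation.ReflTransGen.tail hy ⟨n, hn, hp⟩

theorem inv_init (P : ShortestPathProblem V) (α : ℕ∞) : Inv P α (init P) := by
  have ht : ∀ v n, (init P).tree v = some n → v = P.source ∧ n = ⟨none, 0, 0, 0⟩ := by
    intro v n hn
    by_cases hv : v = P.source
    · simp only [init, hv, if_true] at hn
      cases hn
      exact ⟨hv, rfl⟩
    · simp [init, hv] at hn
  refine ⟨?_, by simp [init], ?_, ?_, ?_, ?_, ?_⟩
  · intro e
    simp [init]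
  · intro v n hn hv
    exact absurd (ht v n hn).1 hv
  · intro u v he
    simp [init] at he
  · intro u v he
    simp [init] at he
  · intro v n c hn _ hw
    obtain ⟨rfl, rfl⟩ := ht v n hn
    simpa [Node.key] using hw.nonneg
  · intro v n hn
    obtain ⟨rfl, rfl⟩ := ht v n hn
    simp

/-! ### Extension steps and their termination -/

section Attach

variable {u v : V} {n : Node V}

theorem attach_tree_self : (attach P s u n v).tree v =
    some ⟨some u, n.c, n.l + P.lazyW (u, v), n.b + 1⟩ := by
  simp [attach]

theorem attach_tree_of_notMem {x : V} (hx : x ∉ s.subtree v) :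
    (attach P s u n v).tree x = s.tree x := by
  have : x ≠ v := fun h => hx (h ▸ Relation.ReflTransGen.refl)
  simp [attach, this, hx]

theorem attach_tree_cases {x : V} {m : Node V} (hm : (attach P s u n v).tree x = some m) :
    (x = v ∧ m = ⟨some u, n.c, n.l + P.lazyW (u, v), n.b + 1⟩) ∨
      (x ∉ s.subtree v ∧ s.tree x = some m) := by
  by_cases hx : x = v
  · subst hx
    rw [attach_tree_self] at hm
    cases hm
    exact Or.inl ⟨rfl, rfl⟩
  · by_cases hx' : x ∈ s.subtree v
    · simp [attach, hx, hx'] at hm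
    · rw [attach_tree_of_notMem hx'] at hm
      exact Or.inr ⟨hx', hm⟩

/-- Attaching creates no cycle: below `v` all keys are at least that of `v`, so no path through such
a vertex improves `v`. -/
theorem Inv.notMem_subtree_of_canAttach (h : Inv P α s) (hc : CanAttach P α s u v) :
    u ∉ s.subtree v := by
  intro hu
  obtain ⟨n, hn, -, -, he, hlt⟩ := hc
  have hpos := P.lazyW_pos _ (h.edges_subset he)
  rcases h.subtree_cases hu with rfl | ⟨m, n', h1, h2, h3, -⟩
  · have := hlt n hn
    linarith
  · rw [hn] at h2
    cases h2
    have := hlt m h1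
    linarith

theorem done_of_done_attach (hd : Done P (attach P s u n v)) : Done P s := by
  obtain ⟨m, hm, hm0⟩ := hd
  rcases attach_tree_cases hm with ⟨-, rfl⟩ | ⟨-, hm'⟩
  · simp at hm0
  · exact ⟨m, hm', hm0⟩

variable [Finite V]

/-- A node of budget 0 is optimal, whereas attaching would exhibit a cheaper walk to it. -/
theorem Inv.budget_pos_of_canAttach (h : Inv P α s) (hc : CanAttach P α s u v) :
    ∀ m, s.tree v = some m → 0 < m.b := by
  intro m hm
  obtain ⟨n, hn, -, -, he, hlt⟩ := hc
  by_contra hb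
  exact (hlt m hm).not_ge
    (h.optimal v m _ hm (by omega) ((h.walk u n hn).snoc he))

theorem Inv.attach (h : Inv P α s) (hn : s.tree u = some n) (hc : CanAttach P α s u v) :
    Inv P α (attach P s u n v) := by
  have hpos := h.budget_pos_of_canAttach hc
  have hu := h.notMem_subtree_of_canAttach hc
  have hz : ∀ {x : V} {m : Node V}, s.tree x = some m → m.b = 0 →
      (LRAStar.attach P s u n v).tree x = some m := fun hx hb => by
    rw [attach_tree_of_notMem (h.notMem_subtree_of_budget_zero hpos hx hb), hx]
  have hvs : v ≠ P.source := by
    rintro rfl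
    simpa using hpos _ h.root
  obtain ⟨n', hn', hut, hb, he, -⟩ := hc
  rw [hn] at hn'
  cases hn'
  refine ⟨h.edges, hz h.root rfl, ?_, ?_, ?_, ?_, ?_⟩
  · intro x m hm hx
    rcases attach_tree_cases hm with ⟨rfl, rfl⟩ | ⟨hxv, hm'⟩
    · refine ⟨u, n, ?_, hm, rfl, hut, hvs, he, ?_, Or.inl ⟨rfl, ?_⟩⟩
      · rw [attach_tree_of_notMem hu, hn]
      · simp [Node.key, add_assoc]
      -- An evaluated edge still in the graph would end in a node of budget 0, and such a node is
      -- never rewired.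
      · intro hev
        obtain ⟨k, hk, -, hk0⟩ := h.evaluated_right u x hev he
        have := hpos k hk
        omega
    · obtain ⟨y, k, hyk⟩ := h.child x m hm' hx
      refine ⟨y, k, ?_, hm, hyk.parent, hyk.ne_target, hyk.ne_source, hyk.mem_edges, hyk.key,
        hyk.budget⟩
      rw [attach_tree_of_notMem fun hy => hxv (mem_subtree_child hm' hyk.parent hy), hyk.left]
  · intro a b hab
    obtain ⟨k, hk, hk0⟩ := h.evaluated_left a b hab
    exact ⟨k, hz hk hk0, hk0⟩
  · intro a b hab hab'
    obtain ⟨k, hk, hkp, hk0⟩ := h.evaluated_right a b hab hab'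
    exact ⟨k, hz hk hk0, hkp, hk0⟩
  · intro x m c hm hm0 hw
    rcases attach_tree_cases hm with ⟨rfl, rfl⟩ | ⟨hxv, hm'⟩
    · simp at hm0
    · exact h.optimal x m c hm' hm0 hw
  · intro x m hm
    rcases attach_tree_cases hm with ⟨rfl, rfl⟩ | ⟨hxv, hm'⟩
    · simpa using Order.add_one_le_of_lt hb
    · exact h.budget_le x m hm'

theorem Inv.extend {s' : State V} (h : Inv P α s)
    (hs : Relation.ReflTransGen (AttachStep P α) s s') :
    Inv P α s' ∧ s'.evaluated = s.evaluated ∧ (Done P s' → Done P s) := by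
  induction hs with
  | refl => exact ⟨h, rfl, id⟩
  | tail _ hst ih =>
    obtain ⟨u, v, n, hn, hc, rfl⟩ := hst
    exact ⟨ih.1.attach hn hc, ih.2.1, fun hd => ih.2.2 (done_of_done_attach hd)⟩

/-- The keys that occur in the search tree. -/
def keys (s : State V) : Set ℝ := {k | ∃ v n, s.tree v = some n ∧ n.key = k}

theorem keys_finite (s : State V) : (keys s).Finite := by
  refine (Set.finite_range fun v => ((s.tree v).map Node.key).getD 0).subset ?_
  rintro k ⟨v, n, hn, rfl⟩
  exact ⟨v, by simp [hn]⟩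

/-- An extension step puts a new key into the search tree
and removes only keys that are larger than this key. -/
theorem Inv.exists_new_key (hP : P.NoTies) (h : Inv P α s) (hn : s.tree u = some n)
    (hc : CanAttach P α s u v) :
    ∃ a ∈ keys (LRAStar.attach P s u n v), a ∉ keys s ∧
      ∀ b ∈ keys s, b ∉ keys (LRAStar.attach P s u n v) → a < b := by
  have h' := h.attach hn hc
  obtain ⟨n', hn', -, -, -, hlt⟩ := hc
  rw [hn] at hn'
  cases hn'
  have hkey : (⟨some u, n.c, n.l + P.lazyW (u, v), n.b + 1⟩ : Node V).key =
      n.key + P.lazyW (u, v) := by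
    simp [Node.key, add_assoc]
  refine ⟨n.key + P.lazyW (u, v), ⟨v, _, attach_tree_self, hkey⟩, ?_, ?_⟩
  -- Without ties, an old node with this key would be the node of `v`, whose old key is strictly
  -- larger.
  · rintro ⟨x, m, hm, hk⟩
    obtain ⟨rfl, -⟩ := h.eq_of_key_eq hP h' hm attach_tree_self (hk.trans hkey.symm)
    exact (hlt m hm).ne hk.symm
  · rintro b ⟨x, m, hm, rfl⟩ hb
    by_cases hx : x ∈ s.subtree v
    · rcases h.subtree_cases hx with rfl | ⟨k, m', h1, h2, h3, -⟩
      · exact hlt m hm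
      · rw [hm] at h2
        cases h2
        exact (hlt k h1).trans h3
    · exact absurd ⟨x, m, by rw [attach_tree_of_notMem hx, hm], rfl⟩ hb

/-- Order the key sets so that the smallest key in which two of them differ belongs to the larger
set. Every step moves up in this order, and only finitely many key sets are possible. -/
theorem Inv.exists_extendBand (hP : P.NoTies) (h : Inv P α s) :
    ∃ s', ExtendBand P α s s' := by
  -- Colex lets the largest differing element decide; passing to `ℝᵒᵈ` makes this the smallest real
  -- key.
  let S : Set (Colex (Finset ℝᵒᵈ)) :=
    {A | ∃ s', Relation.ReflTransGen (AttachStep P α) s s' ∧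
      A = toColex (((keys_finite s').toFinset).map OrderDual.toDual.toEmbedding)}
  have hfin : S.Finite := by
    classical
    have := Fintype.ofFinite V
    -- Keys are costs of duplicate-free vertex lists, of which there are finitely many.
    have hK : (Set.range fun p : {p : List V // p.Nodup} => P.lazyCost p.1).Finite :=
      Set.finite_range _
    refine (((hK.toFinset.map OrderDual.toDual.toEmbedding).powerset.map
      toColex.toEmbedding).finite_toSet).subset ?_
    rintro A ⟨s', hs', rfl⟩
    simp only [Finset.coe_map, Set.mem_image, Finset.mem_coe, Finset.mem_powerset]
    refine ⟨_, Finset.map_subset_map.2 ?_, rfl⟩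
    intro k hk
    rw [Set.Finite.mem_toFinset] at hk ⊢
    obtain ⟨x, m, hm, rfl⟩ := hk
    obtain ⟨p, h1, h2, -⟩ := (h.extend hs').1.path x m hm
    exact ⟨⟨_, h1.2.1⟩, h2⟩
  obtain ⟨A, ⟨s', hs', rfl⟩, hmax⟩ := hfin.exists_maximal ⟨_, s, .refl, rfl⟩
  refine ⟨s', hs', fun u v hc => ?_⟩
  have hn := hc
  obtain ⟨n, hn, -⟩ := hn
  obtain ⟨a, ha, ha', hab⟩ := (h.extend hs').1.exists_new_key hP hn hc
  have hlt : toColex (((keys_finite s').toFinset).map OrderDual.toDual.toEmbedding) <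
      toColex (((keys_finite (LRAStar.attach P s' u n v)).toFinset).map
        OrderDual.toDual.toEmbedding) := by
    rw [Finset.Colex.toColex_lt_toColex_iff_exists_forall_lt]
    refine ⟨OrderDual.toDual a, by simpa using ha, by simpa using ha', ?_⟩
    intro b hb hb'
    have := hab (OrderDual.ofDual b) (by simpa using hb) (by simpa using hb')
    exact this
  exact hlt.not_ge (hmax ⟨_, hs'.tail ⟨u, v, n, hn, hc, rfl⟩, rfl⟩ hlt.le)

end Attach

/-! ### Evaluation of an edge -/

section Evaluate

variable {u v : V} {m n : Node V}

theorem evaluate_tree_of_notMem {x : V} (hx : x ∉ s.subtree v) :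
    (evaluate P s u v).tree x = s.tree x := by
  unfold evaluate
  split_ifs <;> simp [hx]

theorem evaluate_evaluated : (evaluate P s u v).evaluated = insert (u, v) s.evaluated := by
  unfold evaluate
  split_ifs <;> rfl

theorem evaluate_edges_subset : (evaluate P s u v).edges ⊆ s.edges := by
  unfold evaluate
  split_ifs
  · exact subset_rfl
  · exact Set.sdiff_subset

theorem Inv.evaluate_edges (h : Inv P α s) (hc : IsChild P s u v m n) (e : V × V) :
    e ∈ (evaluate P s u v).edges ↔ e ∈ P.edges ∧
      (e ∈ (evaluate P s u v).evaluated → P.w e = (P.lazyW e : WithTop ℝ)) := by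
  have he := h.edges e
  have hce := (h.edges _).1 hc.mem_edges
  by_cases heq : e = (u, v)
  · subst heq
    by_cases hw : P.w (u, v) = (P.lazyW (u, v) : WithTop ℝ)
    · simp [evaluate, hw, hc.mem_edges, hce.1]
    · simp [evaluate, hw]
  · rw [evaluate_evaluated, Set.mem_insert_iff, or_iff_right heq, ← he]
    unfold evaluate
    split_ifs
    · rfl
    · simp [heq]

theorem evaluate_tree_cases {x : V} {k : Node V} (hk : (evaluate P s u v).tree x = some k) :
    (x ∉ s.subtree v ∧ s.tree x = some k) ∨
      (x ∈ s.subtree v ∧ P.w (u, v) = (P.lazyW (u, v) : WithTop ℝ) ∧ ∃ k', s.tree x = some k' ∧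
        k.parent = k'.parent ∧ k.key = k'.key ∧ k.b = k'.b - 1) := by
  by_cases hx : x ∈ s.subtree v
  · right
    by_cases hw : P.w (u, v) = (P.lazyW (u, v) : WithTop ℝ)
    · simp only [evaluate, hw, if_true, hx, Option.map_eq_some_iff] at hk
      obtain ⟨k', hk', rfl⟩ := hk
      refine ⟨hx, hw, k', hk', rfl, ?_, rfl⟩
      simp only [Node.key]
      ring
    · simp [evaluate, hw, hx] at hk
  · rw [evaluate_tree_of_notMem hx] at hk
    exact Or.inl ⟨hx, hk⟩

theorem exists_evaluate_tree_of_mem {x : V} {k : Node V} (hx : x ∈ s.subtree v)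
    (hw : P.w (u, v) = (P.lazyW (u, v) : WithTop ℝ)) (hk : s.tree x = some k) :
    ∃ k', (evaluate P s u v).tree x = some k' ∧
        k'.parent = k.parent ∧ k'.key = k.key ∧ k'.b = k.b - 1 := by
  refine ⟨⟨k.parent, k.c + P.lazyW (u, v), k.l - P.lazyW (u, v), k.b - 1⟩, ?_, rfl, ?_, rfl⟩
  · simp [evaluate, hw, hx, hk]
  · simp only [Node.key]
    ring

/-- If the edge is free, `v` becomes a node of budget 0 and must be optimal, which is `hopt`.
Elsewhere optimality persists because the graph can only shrink. -/
theorem Inv.evaluate (h : Inv P α s) (hc : IsChild P s u v m n) (hm : m.b = 0) (hn : 0 < n.b)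
    (hopt : ∀ c, Walk P s.edges v c → n.key ≤ c) : Inv P α (evaluate P s u v) := by
  have hpos : ∀ m, s.tree v = some m → 0 < m.b := by
    intro k hk
    rw [hc.right] at hk
    cases hk
    exact hn
  have hb : n.b = 1 := by
    have := hc.budget
    omega
  have hz : ∀ {x : V} {m : Node V}, s.tree x = some m → m.b = 0 →
      (LRAStar.evaluate P s u v).tree x = some m := fun hx hb => by
    rw [evaluate_tree_of_notMem (h.notMem_subtree_of_budget_zero hpos hx hb), hx]
  -- Only `v` itself drops to budget 0; its proper descendants keep a positive budget.
  have hsub : ∀ {x : V} {k : Node V}, x ∈ s.subtree v → s.tree x = some k →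
      (x = v ∧ k = n) ∨ 2 ≤ k.b := by
    intro x k hx hk
    rcases h.subtree_cases hx with rfl | ⟨n', k', h1, h2, -, -, h5⟩
    · rw [hc.right] at hk
      cases hk
      exact Or.inl ⟨rfl, rfl⟩
    · rw [hc.right] at h1
      rw [hk] at h2
      cases h1
      cases h2
      have := h5 hn
      omega
  have hvm : v ∈ s.subtree v := Relation.ReflTransGen.refl
  refine ⟨h.evaluate_edges hc, hz h.root rfl, ?_, ?_, ?_, ?_, ?_⟩
  · intro x k hk hx
    have hmem : ∀ y, (y, x) ≠ (u, v) → (y, x) ∈ s.edges →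
        (y, x) ∈ (LRAStar.evaluate P s u v).edges := by
      intro y hy hy'
      unfold LRAStar.evaluate
      split_ifs
      · exact hy'
      · exact ⟨hy', hy⟩
    have hev : ∀ y, (y, x) ≠ (u, v) →
        ((y, x) ∈ (LRAStar.evaluate P s u v).evaluated ↔ (y, x) ∈ s.evaluated) := by
      intro y hy
      rw [evaluate_evaluated, Set.mem_insert_iff, or_iff_right hy]
    rcases evaluate_tree_cases hk with ⟨hxv, hk'⟩ | ⟨hxv, hw, k', hk', hp, hkey, hkb⟩
    · obtain ⟨y, j, hj⟩ := h.child x k hk' hx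
      have hne : (y, x) ≠ (u, v) := by
        rintro ⟨⟩
        exact hxv hvm
      refine ⟨y, j, ?_, hk, hj.parent, hj.ne_target, hx, hmem y hne hj.mem_edges, hj.key, ?_⟩
      · rw [evaluate_tree_of_notMem fun hy => hxv (mem_subtree_child hk' hj.parent hy), hj.left]
      · rw [hev y hne]
        exact hj.budget
    · rcases hsub hxv hk' with ⟨rfl, rfl⟩ | hk2
      · refine ⟨u, m, hz hc.left hm, hk, by rw [hp, hc.parent], hc.ne_target, hx, ?_,
          by rw [hkey, hc.key], Or.inr ⟨hm, by omega, ?_⟩⟩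
        · simp [LRAStar.evaluate, hw, hc.mem_edges]
        · simp [evaluate_evaluated]
      · obtain ⟨y, j, hj⟩ := h.child x k' hk' hx
        have hxne : x ≠ v := by
          rintro rfl
          rw [hc.right] at hk'
          cases hk'
          omega
        have hne : (y, x) ≠ (u, v) := by
          rintro ⟨⟩
          exact hxne rfl
        have hy : y ∈ s.subtree v := by
          rcases Relation.ReflTransGen.cases_tail hxv with h1 | ⟨y', hy', k'', h2, h3⟩
          · exact absurd h1 hxne
          · rw [hk'] at h2
            cases h2
            rw [hj.parent] at h3
            cases h3
            exact hy'
        obtain ⟨j', hj1, -, hj3, hj4⟩ := exists_evaluate_tree_of_mem hy hw hj.left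
        refine ⟨y, j', hj1, hk, by rw [hp, hj.parent], hj.ne_target, hx,
          hmem y hne hj.mem_edges, by rw [hkey, hj3, hj.key], ?_⟩
        rw [hev y hne]
        rcases hj.budget with ⟨h1, h2⟩ | ⟨-, h2, -⟩
        · exact Or.inl ⟨by omega, h2⟩
        · omega
  · intro a b hab
    rw [evaluate_evaluated] at hab
    rcases hab with hab | hab
    · cases hab
      exact ⟨m, hz hc.left hm, hm⟩
    · obtain ⟨k, hk, hk0⟩ := h.evaluated_left a b hab
      exact ⟨k, hz hk hk0, hk0⟩
  · intro a b hab hab'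
    have hw := ((h.evaluate_edges hc _).1 hab').2 hab
    rw [evaluate_evaluated] at hab
    rcases hab with hab | hab
    · cases hab
      obtain ⟨k, hk1, hk2, -, hk4⟩ := exists_evaluate_tree_of_mem hvm hw hc.right
      exact ⟨k, hk1, by rw [hk2, hc.parent], by omega⟩
    · obtain ⟨k, hk, hkp, hk0⟩ := h.evaluated_right a b hab (evaluate_edges_subset hab')
      exact ⟨k, hz hk hk0, hkp, hk0⟩
  · intro x k c hk hk0 hwalk
    have hwalk' := hwalk.mono evaluate_edges_subset
    rcases evaluate_tree_cases hk with ⟨hxv, hk'⟩ | ⟨hxv, hw, k', hk', hp, hkey, hkb⟩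
    · exact h.optimal x k c hk' hk0 hwalk'
    · rcases hsub hxv hk' with ⟨rfl, rfl⟩ | hk2
      · rw [hkey]
        exact hopt c hwalk'
      · omega
  · intro x k hk
    rcases evaluate_tree_cases hk with ⟨hxv, hk'⟩ | ⟨hxv, hw, k', hk', hp, hkey, hkb⟩
    · exact h.budget_le x k hk'
    · refine le_trans ?_ (h.budget_le x k' hk')
      exact_mod_cast (by omega : k.b ≤ k'.b)

end Evaluate

/-! ### Closed bands and the main loop -/

/-- In a closed band, a walk either stays in the search tree or passes a frontier node. -/
theorem Inv.walk_cases (h : Inv P α s) (hcl : ∀ u v, ¬ CanAttach P α s u v) {y : V} {c : ℝ}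
    (hw : Walk P s.edges y c) : (∃ n, s.tree y = some n ∧ n.key ≤ c) ∨
      ∃ z m, IsFrontier P α s z m ∧ m.key ≤ c := by
  induction hw with
  | nil => exact Or.inl ⟨_, h.root, by simp [Node.key]⟩
  | @snoc u v c _ he ih =>
    have hpos := P.lazyW_pos _ (h.edges_subset he)
    rcases ih with ⟨n, hn, hk⟩ | ⟨z, m, hz, hk⟩
    · by_cases hf : (n.b : ℕ∞) = α ∨ u = P.target
      · exact Or.inr ⟨u, n, ⟨hn, hf⟩, by linarith⟩
      · push Not at hf
        have hc := hcl u v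
        simp only [CanAttach, not_exists, not_and] at hc
        have := hc n hn hf.2 (lt_of_le_of_ne (h.budget_le u n hn) hf.1) he
        push Not at this
        obtain ⟨m, hm, hle⟩ := this
        exact Or.inl ⟨m, hm, by linarith⟩
    · exact Or.inr ⟨z, m, hz, by linarith⟩

/-- In a closed band, the nodes with keys at most the keys of all frontier nodes are optimal. -/
theorem Inv.key_le_of_walk (h : Inv P α s) (hcl : ∀ u v, ¬ CanAttach P α s u v) {y : V} {c : ℝ}
    {n : Node V} (hn : s.tree y = some n)
    (hmin : ∀ z m, IsFrontier P α s z m → n.key ≤ m.key)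
    (hw : Walk P s.edges y c) : n.key ≤ c := by
  rcases h.walk_cases hcl hw with ⟨m, hm, hk⟩ | ⟨z, m, hz, hk⟩
  · rw [hn] at hm
    cases hm
    exact hk
  · exact (hmin z m hz).trans hk

/-- The invariant of the main loop. -/
structure Good (P : ShortestPathProblem V) (α : ℕ∞) (s : State V) : Prop extends Inv P α s where
  closed : ∀ u v, ¬ CanAttach P α s u v
  done : Done P s → IsNext P α s P.target

/-- The edge that is evaluated leads to an optimal node with budget `1`,
and it is not evaluated before. -/
theorem Inv.next_edge (h : Inv P α s) {x u v : V} (hcl : ∀ u v, ¬ CanAttach P α s u v)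
    (hx : IsNext P α s x) (he : IsFirstTailEdge s x u v) :
    ∃ m n, IsChild P s u v m n ∧ m.b = 0 ∧ n.b = 1 ∧ (u, v) ∉ s.evaluated ∧
      (∀ z k, IsFrontier P α s z k → n.key ≤ k.key) ∧
      ∀ c, Walk P s.edges v c → n.key ≤ c := by
  obtain ⟨hxv, m, n, hm, hn, hp, hm0, hn0⟩ := he
  obtain ⟨m', hc⟩ := h.isChild_of_parent hn hp
  have := hc.left
  rw [hm] at this
  cases this
  have hmin : ∀ z k, IsFrontier P α s z k → n.key ≤ k.key := by
    intro z k hk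
    obtain ⟨nx, hnx, hmin⟩ := hx
    refine le_trans ?_ (hmin z k hk)
    rcases h.subtree_cases hxv with rfl | ⟨n', k', h1, h2, h3, -⟩
    · have := hnx.1
      rw [hn] at this
      cases this
      exact le_rfl
    · rw [hn] at h1
      rw [hnx.1] at h2
      cases h1
      cases h2
      exact h3.le
  have hb := hc.budget
  refine ⟨m, n, hc, hm0, by omega, ?_, hmin, fun c hw => h.key_le_of_walk hcl hn hmin hw⟩
  rcases hb with hb | hb
  · exact hb.2
  · omega

theorem Good.iteration [Finite V] {s' : State V} (h : Good P α s) (hi : Iteration P α s s') :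
    Good P α s' ∧ ∃ x u v, IsNext P α s x ∧ IsFirstTailEdge s x u v ∧
      (u, v) ∉ s.evaluated ∧ s'.evaluated = insert (u, v) s.evaluated := by
  obtain ⟨hd, x, u, v, hx, he, hs⟩ := hi
  obtain ⟨m, n, hc, hm, hn, hev, hmin, hopt⟩ := h.next_edge h.closed hx he
  have hI := h.toInv.evaluate hc hm (by omega) hopt
  rcases hs with ⟨hd', rfl⟩ | ⟨hd', hs'⟩
  · refine ⟨⟨hI, ?_, ?_⟩, x, u, v, hx, he, hev, evaluate_evaluated⟩
    all_goals
      obtain ⟨k, hk, hk0⟩ := hd'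
      obtain ⟨htv, hw, k', hk', -, hkey, hkb⟩ : P.target ∈ s.subtree v ∧ _ :=
        (evaluate_tree_cases hk).resolve_left fun hk' => hd ⟨k, hk'.2, hk0⟩
      -- The target's budget has just dropped to 0, but proper descendants of `v` had budget at
      -- least 2.
      have hvt : v = P.target := by
        rcases h.subtree_cases htv with h1 | ⟨n', k'', h1, h2, -, -, h5⟩
        · exact h1.symm
        · rw [hc.right] at h1
          rw [hk'] at h2
          cases h1
          cases h2
          have := h5 (by omega)
          omega
      subst hvt
      -- The target is never extended, so it has no children and evaluation changes no other node.
      have hsub : ∀ y ∈ s.subtree P.target, y = P.target := by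
        intro y hy
        rcases Relation.ReflTransGen.cases_head hy with h1 | ⟨z, ⟨j, hj, hjp⟩, -⟩
        · exact h1.symm
        · obtain ⟨j', hj'⟩ := h.isChild_of_parent hj hjp
          exact absurd rfl hj'.ne_target
    -- The band is not extended again here, but it is still closed: keys are unchanged, and the only
    -- changed budget is that of the target.
    · rintro a b ⟨na, hna, hat, hab, he', hlt⟩
      refine h.closed a b ⟨na, ?_, hat, hab, evaluate_edges_subset he', ?_⟩
      · rwa [evaluate_tree_of_notMem fun ha => hat (hsub a ha)] at hna
      · intro j hj
        by_cases hb : b ∈ s.subtree P.target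
        · obtain ⟨j', hj1, -, hj3, -⟩ := exists_evaluate_tree_of_mem hb hw hj
          rw [← hj3]
          exact hlt j' hj1
        · exact hlt j (by rw [evaluate_tree_of_notMem hb, hj])
    · intro _
      refine ⟨k, ⟨hk, Or.inr rfl⟩, fun y j hj => ?_⟩
      by_cases hy : y ∈ s.subtree P.target
      · have := hj.1
        rw [hsub y hy, hk] at this
        cases this
        exact le_rfl
      · have hj1 := hj.1
        rw [evaluate_tree_of_notMem hy] at hj1
        rw [hc.right] at hk'
        cases hk'
        rw [hkey]
        exact hmin y j ⟨hj1, hj.2⟩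
  · obtain ⟨h1, h2, h3⟩ := hI.extend hs'.1
    exact ⟨⟨h1, hs'.2, fun hd => absurd (h3 hd) hd'⟩, x, u, v, hx, he, hev,
      h2.trans evaluate_evaluated⟩

theorem good_of_extendBand_init [Finite V] (hs : ExtendBand P α (init P) s) :
    Good P α s ∧ s.evaluated = ∅ := by
  obtain ⟨h1, h2, h3⟩ := (inv_init P α).extend hs.1
  refine ⟨⟨h1, hs.2, fun hd => ?_⟩, h2⟩
  obtain ⟨n, hn, -⟩ := h3 hd
  by_cases ht : P.target = P.source
  · rw [ht]
    refine ⟨_, ⟨h1.root, Or.inr ht.symm⟩, fun y m hm => ?_⟩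
    simpa [Node.key] using h1.key_nonneg y m hm.1
  · simp [init, ht] at hn

theorem Good.reachable [Finite V] {s' : State V} (h : Good P α s)
    (hs : Relation.ReflTransGen (Iteration P α) s s') : Good P α s' := by
  induction hs with
  | refl => exact h
  | tail _ hi ih => exact (ih.iteration hi).1

theorem Inv.exists_firstTailEdge [Finite V] (h : Inv P α s) :
    ∀ x n, s.tree x = some n → 0 < n.b → ∃ u v, IsFirstTailEdge s x u v := by
  refine h.induction (by simp) ?_
  intro u v m n hc ih hn
  by_cases hm : m.b = 0
  · exact ⟨u, v, .refl, m, n, hc.left, hc.right, hc.parent, hm, hn⟩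
  · obtain ⟨a, b, hub, hab⟩ := ih (by omega)
    exact ⟨a, b, mem_subtree_child hc.right hc.parent hub, hab⟩

theorem Good.exists_iteration [Finite V] (hP : P.NoTies) (hα : 1 ≤ α) (h : Good P α s)
    (hs : ¬ Stops P α s) : ∃ s', Iteration P α s s' := by
  simp only [Stops, not_or, not_forall, not_not] at hs
  obtain ⟨hd, y, ny, hy⟩ := hs
  obtain ⟨x, hx, hmin⟩ := Set.exists_min_image {x | ∃ n, IsFrontier P α s x n}
    (fun x => ((s.tree x).map Node.key).getD 0) (Set.toFinite _) ⟨y, ny, hy⟩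
  obtain ⟨n, hn⟩ := hx
  have hx : IsNext P α s x := by
    refine ⟨n, hn, fun z m hm => ?_⟩
    simpa [hn.1, hm.1] using hmin z ⟨m, hm⟩
  -- Budget 0 would mean `α = 0` or a target already reached; hence the tail has a first edge.
  have hn0 : 0 < n.b := by
    by_contra h0
    have h0 : n.b = 0 := by omega
    rcases hn.2 with h1 | rfl
    · rw [h0] at h1
      simp [← h1] at hα
    · exact hd ⟨n, hn.1, h0⟩
  obtain ⟨u, v, he⟩ := h.exists_firstTailEdge x n hn.1 hn0
  by_cases hd' : Done P (LRAStar.evaluate P s u v)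
  · exact ⟨_, hd, x, u, v, hx, he, Or.inl ⟨hd', rfl⟩⟩
  · obtain ⟨m, k, hc, hm, hk, -, -, hopt⟩ := h.next_edge h.closed hx he
    obtain ⟨s', hs'⟩ := (h.toInv.evaluate hc hm (by omega) hopt).exists_extendBand hP
    exact ⟨s', hd, x, u, v, hx, he, Or.inr ⟨hd', hs'⟩⟩

/-- A reachable state with maximal evaluated set must be a stopping state, since a further iteration
would add a new edge. -/
theorem exists_isEvaluatedSet [Finite V] (hP : P.NoTies) (hα : 1 ≤ α) :
    ∃ E, IsEvaluatedSet P α E := by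
  obtain ⟨s₀, hs₀⟩ := (inv_init P α).exists_extendBand hP
  have hg := (good_of_extendBand_init hs₀).1
  obtain ⟨E, ⟨s, hs, rfl⟩, hmax⟩ := (Set.toFinite
    {E | ∃ s, Relation.ReflTransGen (Iteration P α) s₀ s ∧ s.evaluated = E}).exists_maximal
    ⟨_, s₀, .refl, rfl⟩
  refine ⟨_, s₀, s, hs₀, hs, ?_, rfl⟩
  by_contra hfinal
  obtain ⟨s', hs'⟩ := (hg.reachable hs).exists_iteration hP hα hfinal
  obtain ⟨-, x, u, v, -, -, hev, hins⟩ := (hg.reachable hs).iteration hs'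
  refine hev (hmax ⟨s', hs.tail hs', rfl⟩ ?_ ?_)
  · rw [hins]
    exact Set.subset_insert _ _
  · rw [hins]
    exact Set.mem_insert _ _

/-! ### Comparison of two lookaheads -/

section Comparison

variable {β : ℕ∞} {t : State V}

theorem Inv.edges_anti (h : Inv P α s) (h' : Inv P β t) (hev : s.evaluated ⊆ t.evaluated) :
    t.edges ⊆ s.edges := fun e he => by
  rw [h.edges]
  rw [h'.edges] at he
  exact ⟨he.1, fun hs => he.2 (hev hs)⟩

variable [Finite V]

/-- The evaluated part of the search tree of `s` is a part of the search tree of `t`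
if all edges that are evaluated in `s` are evaluated in `t`. -/
theorem Inv.head_subset (h : Inv P α s) (h' : Inv P β t) (hev : s.evaluated ⊆ t.evaluated) :
    ∀ a n, s.tree a = some n → n.b = 0 →
      ∃ n', t.tree a = some n' ∧ n'.b = 0 ∧ n'.key = n.key := by
  refine h.induction (fun _ => ⟨_, h'.root, rfl, rfl⟩) ?_
  intro u v m n hc ih hn
  rcases hc.budget with ⟨h1, -⟩ | ⟨h1, -, h3⟩
  · omega
  · obtain ⟨m', hm', -, hk⟩ := ih h1
    have he := (h.edges _).1 hc.mem_edges
    -- The edge was found free of collision in `s`, so it also remains in the graph of `t`, where it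
    -- is evaluated and hence a tree edge.
    obtain ⟨n', hn', hp, hn0⟩ := h'.evaluated_right u v (hev h3)
      ((h'.edges _).2 ⟨he.1, fun _ => he.2 h3⟩)
    obtain ⟨m'', hc'⟩ := h'.isChild_of_parent hn' hp
    have := hc'.left
    rw [hm'] at this
    cases this
    exact ⟨n', hn', hn0, by rw [hc'.key, hk, hc.key]⟩

/-- The evaluated part of the search tree of `t` consists of walks in the graph of `s`. -/
theorem Inv.head_walk (h : Inv P α s) (h' : Inv P β t) (hev : s.evaluated ⊆ t.evaluated) {a : V}
    {n : Node V} (hn : t.tree a = some n) : Walk P s.edges a n.key :=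
  (h'.walk a n hn).mono (h.edges_anti h' hev)

/-- If `u` has the same key and budget in both trees, is not a frontier node in `t`, and its child
`v` in `s` is optimal, then `v` has the same key and budget in both trees. -/
theorem Good.exists_child (hP : P.NoTies) (h : Inv P α s) (h' : Good P β t)
    (hev : s.evaluated ⊆ t.evaluated) {u v : V} {m n m' : Node V} (hc : IsChild P s u v m n)
    (hb : n.b = m.b + 1) (hopt : ∀ c, Walk P s.edges v c → n.key ≤ c)
    (hm' : t.tree u = some m') (hk : m'.key = m.key) (hb' : m'.b = m.b)
    (he : (u, v) ∉ t.evaluated) (hβ : (m'.b : ℕ∞) ≠ β) :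
    ∃ n', t.tree v = some n' ∧ n'.key = n.key ∧ n'.b = n.b := by
  have hcl := h'.closed u v
  simp only [CanAttach, not_exists, not_and] at hcl
  have hne := hcl m' hm' hc.ne_target (lt_of_le_of_ne (h'.budget_le u m' hm') hβ)
    ((h'.edges _).2 ⟨h.edges_subset hc.mem_edges, fun h => absurd h he⟩)
  push Not at hne
  obtain ⟨n', hn', hle⟩ := hne
  rw [hk, ← hc.key] at hle
  -- Closedness of `t` gives one inequality. The other holds because the tree path in `t` is a walk
  -- in the graph of `s`.
  have hkey : n'.key = n.key := le_antisymm hle (hopt _ (h.head_walk h'.toInv hev hn'))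
  obtain ⟨-, hp⟩ := h'.eq_of_key_eq hP h hn' hc.right hkey
  obtain ⟨m'', hc'⟩ := h'.isChild_of_parent hn' (hp.trans hc.parent)
  have := hc'.left
  rw [hm'] at this
  cases this
  refine ⟨n', hn', hkey, ?_⟩
  rcases hc'.budget with ⟨h1, -⟩ | ⟨-, -, h3⟩
  · omega
  · exact absurd h3 he

/-- The tree path to `x` is traced in `t` until it meets a frontier node of positive budget, which
is incompatible with `t` having stopped. -/
theorem Good.mem_evaluated (hP : P.NoTies) (hβ : 1 ≤ β) (hαβ : β < α) (h : Good P α s)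
    (h' : Good P β t) (hev : s.evaluated ⊆ t.evaluated) (hfinal : Stops P β t) {x u v : V}
    (hx : IsNext P α s x) (he : IsFirstTailEdge s x u v) : (u, v) ∈ t.evaluated := by
  by_contra hne
  obtain ⟨m, n, hc, hm, hn, -, -, hopt⟩ := h.next_edge h.closed hx he
  obtain ⟨nx, hnx, hmin⟩ := hx
  obtain ⟨m', hm', hm0, hk⟩ := h.head_subset h'.toInv hev u m hc.left hm
  -- The tracing starts at `u`, which has budget 0 in both trees and so is below the lookahead `β ≥
  -- 1`.
  obtain ⟨n', hn', hkn, hbn⟩ := Good.exists_child hP h.toInv h' hev hc (by omega) hopt hm' hk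
    (by omega) hne (by
      rw [hm0]
      rintro rfl
      simp at hβ)
  -- The first vertex on the tree path to `x` that has a frontier node in `t`.
  have key : ∀ z, Relation.ReflTransGen
      (fun y z => ∃ n, s.tree z = some n ∧ n.parent = some y) z x →
      ∀ k k', s.tree z = some k → t.tree z = some k' → k'.key = k.key → k'.b = k.b → 0 < k.b →
      ∃ y j j', s.tree y = some j ∧ IsFrontier P β t y j' ∧ j'.key = j.key ∧ j'.b = j.b ∧
        0 < j.b ∧ (y = P.target ∨ j.key < nx.key) := by
    intro z hz
    induction hz using Relation.ReflTransGen.head_induction_on with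
    | refl =>
      intro k k' hk hk' hkey hb h0
      have hxt := hnx.1
      rw [hk] at hxt
      cases hxt
      -- Budgets in `t` are at most `β < α`, so `x` cannot be a frontier node by its budget.
      have hxP : x = P.target := hnx.2.resolve_left fun hα => by
        have := h'.budget_le x k' hk'
        rw [hb, hα] at this
        exact this.not_gt hαβ
      exact ⟨x, nx, k', hk, ⟨hk', Or.inr hxP⟩, hkey, hb, h0, Or.inl hxP⟩
    | @head z z' hzz' hz'x ih =>
      intro k k' hk hk' hkey hb h0
      obtain ⟨k₁, hk₁, hp⟩ := hzz'
      obtain ⟨k₂, hc₁⟩ := h.isChild_of_parent hk₁ hp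
      have := hc₁.left
      rw [hk] at this
      cases this
      have hb₁ : k₁.b = k.b + 1 := by
        have := hc₁.budget
        omega
      have hle : k₁.key ≤ nx.key := by
        rcases h.subtree_cases hz'x with rfl | ⟨j, j', h1, h2, h3, -⟩
        · have := hnx.1
          rw [hk₁] at this
          cases this
          exact le_rfl
        · rw [hk₁] at h1
          rw [hnx.1] at h2
          cases h1
          cases h2
          exact h3.le
      by_cases hβ' : (k'.b : ℕ∞) = β
      · exact ⟨z, k, k', hk, ⟨hk', Or.inl hβ'⟩, hkey, hb, h0,
          Or.inr ((h.key_lt hc₁).trans_le hle)⟩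
      · obtain ⟨k₁', h1, h2, h3⟩ := Good.exists_child hP h.toInv h' hev hc₁ hb₁
          (fun c hw => h.key_le_of_walk h.closed hk₁
            (fun y j hj => hle.trans (hmin y j hj)) hw) hk' hkey hb (fun hzz => by
              obtain ⟨j, hj, hj0⟩ := h'.evaluated_left z z' hzz
              rw [hk'] at hj
              cases hj
              omega) hβ'
        exact ih k₁ k₁' hk₁ h1 h2 h3 (by omega)
  obtain ⟨y, j, j', hj, hj', hjk, hjb, hj0, hyx⟩ :=
    key v he.1 n n' hc.right hn' hkn hbn (by omega)
  rcases hfinal with hd | hf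
  · have hnt := h'.done hd
    obtain ⟨k, hk, hk0⟩ := hd
    obtain ⟨k', hk', hmin'⟩ := hnt
    have := hk'.1
    rw [hk] at this
    cases this
    have hle := hmin' y j' hj'
    rcases hyx with rfl | hlt
    · have := hj'.1
      rw [hk] at this
      cases this
      omega
    -- The tree path to the target in `t` is a walk in the graph of `s` cheaper than the key of `x`.
    -- It yields a frontier node of `s` with key below the minimum.
    · rcases h.walk_cases h.closed (h.head_walk h'.toInv hev hk) with ⟨i, hi, hi'⟩ | ⟨z, i, hi, hi'⟩
      · have := hmin _ i ⟨hi, Or.inr rfl⟩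
        linarith
      · have := hmin _ i hi
        linarith
  · exact hf y j' hj'

end Comparison

theorem isEvaluatedSet_subset [Finite V] (hP : P.NoTies) {β : ℕ∞} (hβ : 1 ≤ β) (hαβ : β < α)
    {E F : Set (V × V)} (hE : IsEvaluatedSet P α E) (hF : IsEvaluatedSet P β F) : E ⊆ F := by
  obtain ⟨s₀, s, hs₀, hs, -, rfl⟩ := hE
  obtain ⟨t₀, t, ht₀, ht, hfinal, rfl⟩ := hF
  have ht' := (good_of_extendBand_init ht₀).1.reachable ht
  obtain ⟨hg, h0⟩ := good_of_extendBand_init hs₀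
  -- The induction runs along the execution with lookahead `α` only; `t` stays the final state of
  -- the other one.
  suffices Good P α s ∧ s.evaluated ⊆ t.evaluated from this.2
  induction hs with
  | refl => exact ⟨hg, by simp [h0]⟩
  | tail _ hi ih =>
    obtain ⟨h1, x, u, v, hx, he, -, hins⟩ := ih.1.iteration hi
    refine ⟨h1, ?_⟩
    rw [hins]
    exact Set.insert_subset (ih.1.mem_evaluated hP hβ hαβ ht' ih.2 hfinal hx he) ih.2

end LRAStar

theorem mainTheorem3 {V : Type*} [Finite V] (P : ShortestPathProblem V) (hP : P.NoTies)
    (α₁ α₂ : ℕ∞) (hα₂ : 1 ≤ α₂) (hα : α₂ < α₁) :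
    (∃ E₁, LRAStar.IsEvaluatedSet P α₁ E₁) ∧ (∃ E₂, LRAStar.IsEvaluatedSet P α₂ E₂) ∧
      ∀ E₁ E₂, LRAStar.IsEvaluatedSet P α₁ E₁ → LRAStar.IsEvaluatedSet P α₂ E₂ → E₁ ⊆ E₂ :=
  ⟨LRAStar.exists_isEvaluatedSet hP (hα₂.trans hα.le), LRAStar.exists_isEvaluatedSet hP hα₂,
    fun _ _ h₁ h₂ => LRAStar.isEvaluatedSet_subset hP hα₂ hα h₁ h₂⟩
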